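/- **Theorem 1.3.** For $n\ge 0$, let $\mathsf C_n$ be the chain with $n$ elements, viewed as a rooted tree whose root is the maximum element. An *ornamentation* of $\mathsf C_n$ is a function $\delta$ assigning to each $v\in\mathsf C_n$ a set $\delta(v)\subseteq\mathsf C_n$ that induces a connected subgraph of the Hasse diagram and has $v$ as its unique maximal element, such that for all $v,v'$ the sets $\delta(v)$ and $\delta(v')$ are nested or disjoint. Let $\mathcal O(\mathsf C_n)$ be the set of ornamentations of $\mathsf C_n$, ordered by $\delta\le\delta'$ if and only if $\delta(v)\subseteq\delta'(v)$ for all $v$; it is a lattice isomorphic to the $n$-th Tamari lattice, and its meet is pointwise intersection. Let $\mathsf{Pop}\colon\mathcal O(\mathsf C_n)\to\mathcal O(\mathsf C_n)$ be the pop-stack operator, $\mathsf{Pop}(\delta)=\bigwedge\bigl(\{\delta\}\cup\{\sigma:\sigma\lessdot\delta\}\bigr)$, where $\sigma\lessdot\delta$ means that $\delta$ covers $\sigma$. Then for each integer $k\ge 0$, $$\sum_{n\ge 0}\bigl|\mathsf{Pop}^k(\mathcal O(\mathsf C_n))\bigr|\,x^n=\frac{1-x^{k+1}-\sqrt{(1-x^{k+1})^2-4x(1-x)(1-x^{k+1})}}{2x(1-x)}$$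 as formal power series over $\mathbb Q$, where the square root is the one with constant term $1$. In particular, $|\mathcal O(\mathsf C_n)|$ is the $n$-th Catalan number for every $n\ge 0$ (the case $k=0$), and (the case $k=1$) $|\mathsf{Pop}(\mathcal O(\mathsf C_0))|=1$ and $|\mathsf{Pop}(\mathcal O(\mathsf C_{n+1}))|=M_n$ for every $n\ge 0$, where the Motzkin numbers $M_n$ are given by $M_0=1$ and $M_{n+1}=M_n+\sum_{i=0}^{n-1}M_iM_{n-1-i}$. -/

import Mathlib

open scoped PowerSeries

/-- A finite poset whose principal up-sets are chains is the poset of a rooted forest ordered with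
the roots on top; it is a rooted tree when it moreover has a top element. Here only the chain
condition is recorded. Finite linear orders, including the empty one, are examples. -/
class IsForestOrder (T : Type*) [PartialOrder T] : Prop where
  le_or_le_of_le : ∀ {a b c : T}, a ≤ b → a ≤ c → b ≤ c ∨ c ≤ b

instance LinearOrder.isForestOrder (T : Type*) [LinearOrder T] : IsForestOrder T where
  le_or_le_of_le {_ b c} _ _ := le_total b c

/-- An ornament of `T`: a set of nodes inducing a connected subgraph of the Hasse diagram. -/
def IsOrnament {T : Type*} [PartialOrder T] (s : Set T) : Prop :=
  ((SimpleGraph.hasse T).induce s).Connected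

/-- Ornamentations of `T`. In a finite poset, a set has `v` as its unique maximal element if and
only if `v` is its greatest element. -/
@[ext]
structure Ornamentation (T : Type*) [PartialOrder T] where
  orn : T → Set T
  isOrnament : ∀ v, IsOrnament (orn v)
  isGreatest : ∀ v, IsGreatest (orn v) v
  nested_or_disjoint : ∀ v w, orn v ⊆ orn w ∨ orn w ⊆ orn v ∨ Disjoint (orn v) (orn w)

namespace Ornamentation

variable {T : Type*} [PartialOrder T]

theorem orn_injective : Function.Injective (orn : Ornamentation T → T → Set T) :=
  fun _ _ h => Ornamentation.ext h

/-- `δ ≤ δ'` if and only if `δ(v) ⊆ δ'(v)` for all nodes `v`. -/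
instance : PartialOrder (Ornamentation T) where
  le δ δ' := ∀ v, δ.orn v ⊆ δ'.orn v
  le_refl _ _ := subset_rfl
  le_trans _ _ _ h h' v := (h v).trans (h' v)
  le_antisymm _ _ h h' := orn_injective (funext fun v => (h v).antisymm (h' v))

instance [Finite T] : Finite (Ornamentation T) :=
  Finite.of_injective _ orn_injective

/-- In a forest, a connected set with greatest element `v` contains every interval `[w, v]`
starting at one of its points. -/
theorem mem_of_isOrnament [IsForestOrder T] {s : Set T} (hs : IsOrnament s) {u v w : T}
    (hv : v ∈ s) (hw : w ∈ s) (hwu : w ≤ u) (huv : u ≤ v) : u ∈ s := by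
  by_contra hu
  have key : ∀ (a b : s), ((SimpleGraph.hasse T).induce s).Walk a b →
      (a : T) ≤ u → (b : T) ≤ u := by
    intro a b p
    induction p with
    | nil => exact id
    | @cons a b c hab _ ih =>
      intro hau
      apply ih
      have h : (a : T) ⋖ b ∨ (b : T) ⋖ a := by simpa using hab
      rcases h with h | h
      · rcases IsForestOrder.le_or_le_of_le h.le hau with h1 | h1
        · exact h1
        · have hne : (a : T) ≠ u := fun e => hu (e ▸ a.2)
          have hne' : u ≠ b := fun e => hu (e ▸ b.2)
          exact absurd (lt_of_le_of_ne h1 hne') (h.2 (lt_of_le_of_ne hau hne))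
      · exact h.le.trans hau
  obtain ⟨p⟩ := hs.preconnected ⟨w, hw⟩ ⟨v, hv⟩
  exact hu (le_antisymm huv (key _ _ p hwu) ▸ hv)

/-- Conversely, in a finite poset, a set with greatest element `v` that contains the interval
`[w, v]` for each of its points `w` is connected. -/
theorem isOrnament_of_mem [Finite T] {s : Set T} {v : T} (hv : IsGreatest s v)
    (h : ∀ w ∈ s, ∀ u, w ≤ u → u ≤ v → u ∈ s) : IsOrnament s := by
  have key : ∀ w : T, ∀ hw : w ∈ s,
      ((SimpleGraph.hasse T).induce s).Reachable ⟨w, hw⟩ ⟨v, hv.1⟩ := by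
    intro w
    induction w using WellFoundedGT.induction with
    | _ w ih =>
      intro hw
      rcases (hv.2 hw).eq_or_lt with rfl | hlt
      · exact SimpleGraph.Reachable.refl _
      · obtain ⟨u, hwu, huv⟩ := exists_covBy_le_of_lt hlt
        have hus := h w hw u hwu.le huv
        refine SimpleGraph.Reachable.trans (SimpleGraph.Adj.reachable ?_) (ih u hwu.lt hus)
        simp [hwu]
  have : Nonempty s := ⟨⟨v, hv.1⟩⟩
  exact ⟨fun a b => (key a a.2).trans (key b b.2).symm⟩

/-- The meet of two ornamentations is the pointwise intersection. -/
instance [Finite T] [IsForestOrder T] : SemilatticeInf (Ornamentation T) where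
  inf δ δ' :=
    { orn := fun v => δ.orn v ∩ δ'.orn v
      isOrnament := fun v => isOrnament_of_mem
        ⟨⟨(δ.isGreatest v).1, (δ'.isGreatest v).1⟩, fun _ hw => (δ.isGreatest v).2 hw.1⟩
        fun _ hw _ hwu huv =>
          ⟨mem_of_isOrnament (δ.isOrnament v) (δ.isGreatest v).1 hw.1 hwu huv,
            mem_of_isOrnament (δ'.isOrnament v) (δ'.isGreatest v).1 hw.2 hwu huv⟩
      isGreatest := fun v =>
        ⟨⟨(δ.isGreatest v).1, (δ'.isGreatest v).1⟩, fun _ hw => (δ.isGreatest v).2 hw.1⟩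
      nested_or_disjoint := by
        have aux : ∀ v w : T, v ≤ w → δ.orn v ∩ δ'.orn v ⊆ δ.orn w ∩ δ'.orn w ∨
            Disjoint (δ.orn v ∩ δ'.orn v) (δ.orn w ∩ δ'.orn w) := by
          intro v w hvw
          have sub : ∀ ε : Ornamentation T, ε.orn v ⊆ ε.orn w ∨ Disjoint (ε.orn v) (ε.orn w) := by
            intro ε
            rcases ε.nested_or_disjoint v w with h | h | h
            · exact Or.inl h
            · have : w = v := le_antisymm ((ε.isGreatest v).2 (h (ε.isGreatest w).1)) hvw
              exact Or.inl (this ▸ subset_rfl)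
            · exact Or.inr h
          rcases sub δ with h | h
          · rcases sub δ' with h' | h'
            · exact Or.inl (Set.inter_subset_inter h h')
            · exact Or.inr (h'.mono Set.inter_subset_right Set.inter_subset_right)
          · exact Or.inr (h.mono Set.inter_subset_left Set.inter_subset_left)
        intro v w
        by_cases hd : Disjoint (δ.orn v ∩ δ'.orn v) (δ.orn w ∩ δ'.orn w)
        · exact Or.inr (Or.inr hd)
        · obtain ⟨x, hx, hx'⟩ := Set.not_disjoint_iff.1 hd
          rcases IsForestOrder.le_or_le_of_le ((δ.isGreatest v).2 hx.1)
            ((δ.isGreatest w).2 hx'.1) with h | h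
          · exact Or.inl ((aux v w h).resolve_right hd)
          · exact Or.inr (Or.inl ((aux w v h).resolve_right fun h' => hd h'.symm)) }
  inf_le_left _ _ _ := Set.inter_subset_left
  inf_le_right _ _ _ := Set.inter_subset_right
  le_inf _ _ _ h h' v := Set.subset_inter (h v) (h' v)

end Ornamentation

/-- The pop-stack operator: `x` is sent to the meet of `x` and all elements covered by `x`.
Only meets are needed, so every finite lattice is covered. -/
noncomputable def popStack {L : Type*} [SemilatticeInf L] [Finite L] (x : L) : L :=
  (Set.toFinite (insert x {y : L | y ⋖ x})).toFinset.inf' ⟨x, by simp⟩ id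

/-- The number of elements in the image of the `k`-th iterate of the pop-stack operator on the
ornamentation lattice of the chain with `n` elements (the `n`-th Tamari lattice). -/
noncomputable def popImageCard (k n : ℕ) : ℕ :=
  (Set.range (popStack (L := Ornamentation (Fin n)))^[k]).ncard

/-- The Motzkin numbers 1, 1, 2, 4, 9, 21, ... -/
def motzkin : ℕ → ℕ
  | 0 => 1
  | n + 1 => motzkin n + ∑ i : Fin n, motzkin i * motzkin (n - 1 - i)

/-! An ornamentation of a chain is a family of intervals `[m w, w]`, hence a bracket vector `m`,
with the order reversed. An element covered by it arises by shortening one nontrivial interval to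
`[p + 1, w]`, where `p` is the last earlier position with the same left end; so the pop-stack
operator performs all these shortenings at once (`leftEnd_popStack`).

One pop makes the left ends of the nontrivial intervals pairwise distinct. From then on `p` is the
left end itself, and each further pop only deletes the leftmost point of every nontrivial interval.
This leaves a run of trivial positions ending at each left end, and conversely such vectors have
explicit preimages (`image_iterate_popVector`).

To count, the vector is filled in from left to right. The number of completions depends only on the
number `h` of left ends still available and, for `k ≥ 1`, on the waiting time `c` until a position
can next serve as a left end. The generating functions are `F ^ (h + 1)` with `F = 1 + X F ^ 2` for
`k = 0`, and `R c * R k ^ h` for `k ≥ 1`. Eliminating the other `R c` shows that `F = R k` solves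
`(1 - X ^ (k + 1)) (F - 1) = X (1 - X) F ^ 2`, and the quadratic formula gives the closed form. -/

/-! ### Bracket vectors and their pop-stack operator -/

/-- Bracket vectors of length `n`, extended by the identity beyond `n`: the interval `[m w, w]`
contains `[m x, x]` whenever it contains `x`. -/
structure IsBracketVector (n : ℕ) (m : ℕ → ℕ) : Prop where
  le_self : ∀ w, m w ≤ w
  nested : ∀ w x, m w ≤ x → x ≤ w → m w ≤ m x
  eq_self : ∀ w, n ≤ w → m w = w

namespace IsBracketVector

variable {n : ℕ} {m : ℕ → ℕ}

theorem map_map (h : IsBracketVector n m) (w : ℕ) : m (m w) = m w :=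
  le_antisymm (h.le_self _) (h.nested _ _ le_rfl (h.le_self w))

theorem lt_of_lt_self (h : IsBracketVector n m) {w : ℕ} (hw : m w < w) : w < n := by
  by_contra hn
  have := h.eq_self w (by omega)
  omega

end IsBracketVector

/-- The pop-stack operator on bracket vectors: a nontrivial interval `[m w, w]` is shortened to
`[p + 1, w]`, where `p` is the last position before `w` with the same left end. -/
def popVector (m : ℕ → ℕ) (w : ℕ) : ℕ :=
  if m w = w then w else Nat.findGreatest (fun p => m p = m w) (w - 1) + 1

theorem popVector_of_eq {m : ℕ → ℕ} {w : ℕ} (h : m w = w) : popVector m w = w := if_pos h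

theorem popVector_eq {m : ℕ → ℕ} {w p : ℕ} (hw : m w ≠ w) (hp : p < w) (hmp : m p = m w)
    (hx : ∀ x, p < x → x < w → m x ≠ m w) : popVector m w = p + 1 := by
  rw [popVector, if_neg hw, Nat.findGreatest_eq_iff.2]
  exact ⟨by omega, fun _ => hmp, fun {x} h1 h2 => hx x h1 (by omega)⟩

namespace IsBracketVector

variable {n : ℕ} {m : ℕ → ℕ}

/-- If `x` lies strictly between `p` and `w` and its interval reached `p`, nesting in both
directions would force `m x = m w`, against the choice of `p` as the last such position. -/
theorem exists_popVector_eq (h : IsBracketVector n m) {w : ℕ} (hw : m w < w) :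
    ∃ p, popVector m w = p + 1 ∧ m w ≤ p ∧ p < w ∧ m p = m w ∧
      ∀ x, p < x → x < w → p < m x := by
  have hs : m (Nat.findGreatest (fun p => m p = m w) (w - 1)) = m w :=
    Nat.findGreatest_spec (P := fun p => m p = m w) (m := m w) (by omega) (h.map_map w)
  have hle : Nat.findGreatest (fun p => m p = m w) (w - 1) ≤ w - 1 := Nat.findGreatest_le _
  have hge : m w ≤ Nat.findGreatest (fun p => m p = m w) (w - 1) :=
    Nat.le_findGreatest (by omega) (h.map_map w)
  have hgr : ∀ x, Nat.findGreatest (fun p => m p = m w) (w - 1) < x → x ≤ w - 1 → m x ≠ m w :=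
    fun x h1 h2 => Nat.findGreatest_is_greatest (P := fun p => m p = m w) h1 h2
  refine ⟨Nat.findGreatest (fun p => m p = m w) (w - 1), if_neg (by omega), hge, by omega, hs, ?_⟩
  generalize Nat.findGreatest (fun p => m p = m w) (w - 1) = p at *
  intro x hpx hxw
  by_contra hlt
  have h1 := h.nested w x (by omega) hxw.le
  have h2 := h.nested x p (by omega) hpx.le
  exact hgr x hpx (by omega) (by omega)

theorem popVector_le (h : IsBracketVector n m) (w : ℕ) : popVector m w ≤ w := by
  rcases (h.le_self w).eq_or_lt with hw | hw
  · exact (popVector_of_eq hw).le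
  · obtain ⟨p, hp, hmp, hpw, -⟩ := h.exists_popVector_eq hw
    omega

theorem le_popVector (h : IsBracketVector n m) (w : ℕ) : m w ≤ popVector m w := by
  rcases (h.le_self w).eq_or_lt with hw | hw
  · exact (hw.trans (popVector_of_eq hw).symm).le
  · obtain ⟨p, hp, hmp, hpw, -⟩ := h.exists_popVector_eq hw
    omega

theorem lt_popVector (h : IsBracketVector n m) {w : ℕ} (hw : m w < w) : m w < popVector m w := by
  obtain ⟨p, hp, hmp, hpw, -⟩ := h.exists_popVector_eq hw
  omega

theorem popVector_le_of_mem (h : IsBracketVector n m) {w x : ℕ} (hx : popVector m w ≤ x)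
    (hxw : x < w) : popVector m w ≤ m x := by
  rcases (h.le_self w).eq_or_lt with hw | hw
  · rw [popVector_of_eq hw] at hx
    omega
  · obtain ⟨p, hp, -, hpw, -, hgr⟩ := h.exists_popVector_eq hw
    have := hgr x (by omega) hxw
    omega

protected theorem popVector (h : IsBracketVector n m) : IsBracketVector n (popVector m) where
  le_self := h.popVector_le
  nested w x hx hxw := by
    rcases hxw.eq_or_lt with rfl | hlt
    · exact le_rfl
    · exact (h.popVector_le_of_mem hx hlt).trans (h.le_popVector x)
  eq_self w hw := popVector_of_eq (h.eq_self w hw)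

/-- Shortening a single interval gives again a bracket vector. -/
theorem update_popVector (h : IsBracketVector n m) (v : ℕ) :
    IsBracketVector n (Function.update m v (popVector m v)) where
  le_self w := by
    rcases eq_or_ne w v with rfl | hw
    · simpa using h.popVector_le w
    · simpa [hw] using h.le_self w
  nested w x hx hxw := by
    rcases hxw.eq_or_lt with rfl | hlt
    · exact le_rfl
    have hmx : m x ≤ Function.update m v (popVector m v) x := by
      rcases eq_or_ne x v with rfl | hx
      · simpa using h.le_popVector x
      · simp [hx]
    refine le_trans ?_ hmx
    rcases eq_or_ne w v with rfl | hw
    · simp only [Function.update_self] at hx ⊢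
      exact h.popVector_le_of_mem hx hlt
    · simp only [Function.update_of_ne hw] at hx ⊢
      exact h.nested _ _ hx hxw
  eq_self w hw := by
    rcases eq_or_ne w v with rfl | hv
    · simpa using popVector_of_eq (h.eq_self w hw)
    · simpa [hv] using h.eq_self w hw

/-- If `s` is pointwise at least `m` and `v` is the first position where they differ, then
`s v` is at least `popVector m v`. -/
theorem popVector_le_of_first_ne (h : IsBracketVector n m) {s : ℕ → ℕ} (hs : IsBracketVector n s)
    (hms : ∀ w, m w ≤ s w) {v : ℕ} (hv : m v ≠ s v) (hlt : ∀ w < v, m w = s w) :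
    popVector m v ≤ s v := by
  have h1 := hms v
  have h2 := hs.le_self v
  obtain ⟨p, hp, hmp, hpv, hpe, -⟩ := h.exists_popVector_eq (w := v) (by omega)
  by_contra hcon
  have := hs.nested v p (by omega) hpv.le
  have := hlt p hpv
  omega

end IsBracketVector

/-! ### Ornamentations of a chain as bracket vectors -/

namespace Ornamentation

variable {n : ℕ}

/-- The left ends of the intervals `δ(v)`, extended by the identity. -/
noncomputable def leftEnd (δ : Ornamentation (Fin n)) (w : ℕ) : ℕ :=
  if h : w < n then sInf ((fun x : Fin n => (x : ℕ)) '' δ.orn ⟨w, h⟩) else w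

theorem mem_orn_iff (δ : Ornamentation (Fin n)) (v x : Fin n) :
    x ∈ δ.orn v ↔ δ.leftEnd v ≤ x ∧ x ≤ v := by
  have hne : ((fun x : Fin n => (x : ℕ)) '' δ.orn v).Nonempty := ⟨v, v, (δ.isGreatest v).1, rfl⟩
  simp only [leftEnd, v.2, dif_pos]
  constructor
  · exact fun hx => ⟨Nat.sInf_le ⟨x, hx, rfl⟩, (δ.isGreatest v).2 hx⟩
  · rintro ⟨h1, h2⟩
    obtain ⟨y, hy, hy'⟩ := Nat.sInf_mem hne
    simp only at hy'
    exact mem_of_isOrnament (δ.isOrnament v) (δ.isGreatest v).1 hy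
      (Fin.le_def.2 (hy'.trans_le h1)) h2

theorem leftEnd_of_le (δ : Ornamentation (Fin n)) {w : ℕ} (hw : n ≤ w) : δ.leftEnd w = w :=
  dif_neg hw.not_gt

theorem leftEnd_le (δ : Ornamentation (Fin n)) (w : ℕ) : δ.leftEnd w ≤ w := by
  rcases lt_or_ge w n with hw | hw
  · exact ((δ.mem_orn_iff ⟨w, hw⟩ ⟨w, hw⟩).1 (δ.isGreatest _).1).1
  · exact (δ.leftEnd_of_le hw).le

theorem isBracketVector_leftEnd (δ : Ornamentation (Fin n)) : IsBracketVector n δ.leftEnd where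
  le_self := δ.leftEnd_le
  nested w x hx hxw := by
    rcases lt_or_ge w n with hw | hw
    · have hxn := hxw.trans_lt hw
      have hmem := (δ.mem_orn_iff ⟨w, hw⟩ ⟨x, hxn⟩).2 ⟨hx, hxw⟩
      rcases δ.nested_or_disjoint ⟨w, hw⟩ ⟨x, hxn⟩ with h | h | h
      · have : w ≤ x := (δ.isGreatest _).2 (h (δ.isGreatest _).1)
        rw [le_antisymm this hxw]
      · exact ((δ.mem_orn_iff ⟨w, hw⟩ ⟨δ.leftEnd x, (δ.leftEnd_le x).trans_lt hxn⟩).1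
          (h ((δ.mem_orn_iff ⟨x, hxn⟩ _).2 ⟨le_rfl, δ.leftEnd_le x⟩))).1
      · exact absurd (δ.isGreatest ⟨x, hxn⟩).1 (Set.disjoint_left.1 h hmem)
    · rw [δ.leftEnd_of_le hw] at hx
      rw [le_antisymm hxw hx]
  eq_self _ := δ.leftEnd_of_le

/-- Larger sets have smaller left ends, so the order is reversed. -/
theorem le_iff_leftEnd {δ ε : Ornamentation (Fin n)} :
    δ ≤ ε ↔ ∀ w, ε.leftEnd w ≤ δ.leftEnd w := by
  constructor
  · intro h w
    rcases lt_or_ge w n with hw | hw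
    · exact ((ε.mem_orn_iff ⟨w, hw⟩ ⟨δ.leftEnd w, (δ.leftEnd_le w).trans_lt hw⟩).1
        (h _ ((δ.mem_orn_iff ⟨w, hw⟩ _).2 ⟨le_rfl, δ.leftEnd_le w⟩))).1
    · rw [leftEnd_of_le _ hw, leftEnd_of_le _ hw]
  · intro h v x hx
    rw [mem_orn_iff] at hx ⊢
    exact ⟨(h v).trans hx.1, hx.2⟩

theorem leftEnd_injective : Function.Injective (leftEnd : Ornamentation (Fin n) → ℕ → ℕ) :=
  fun _ _ h => le_antisymm (le_iff_leftEnd.2 fun _ => (congrFun h _).ge)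
    (le_iff_leftEnd.2 fun _ => (congrFun h _).le)

theorem exists_leftEnd_eq {m : ℕ → ℕ} (h : IsBracketVector n m) :
    ∃ δ : Ornamentation (Fin n), δ.leftEnd = m := by
  have hg : ∀ v : Fin n, IsGreatest {x : Fin n | m v ≤ x ∧ x ≤ v} v :=
    fun v => ⟨⟨h.le_self v, le_rfl⟩, fun _ hx => hx.2⟩
  let δ : Ornamentation (Fin n) :=
    { orn := fun v => {x | m v ≤ x ∧ x ≤ v}
      isOrnament := fun v => isOrnament_of_mem (hg v)
        fun w hw u hwu huv => ⟨hw.1.trans hwu, huv⟩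
      isGreatest := hg
      nested_or_disjoint := by
        have aux : ∀ v w : Fin n, v ≤ w → {x : Fin n | m v ≤ x ∧ x ≤ v} ⊆ {x | m w ≤ x ∧ x ≤ w} ∨
            Disjoint {x : Fin n | m v ≤ x ∧ x ≤ v} {x | m w ≤ x ∧ x ≤ w} := by
          intro v w hvw
          rcases le_or_gt (m w) v with hc | hc
          · exact Or.inl fun x hx => ⟨(h.nested w v hc hvw).trans hx.1, hx.2.trans hvw⟩
          · refine Or.inr (Set.disjoint_left.2 fun x hx hx' => ?_)
            have h1 : (x : ℕ) ≤ v := hx.2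
            have h2 : m w ≤ x := hx'.1
            omega
        intro v w
        rcases le_total v w with hvw | hvw
        · rcases aux v w hvw with h | h
          · exact Or.inl h
          · exact Or.inr (Or.inr h)
        · rcases aux w v hvw with h | h
          · exact Or.inr (Or.inl h)
          · exact Or.inr (Or.inr h.symm) }
  refine ⟨δ, funext fun w => ?_⟩
  rcases lt_or_ge w n with hw | hw
  · apply le_antisymm
    · exact ((δ.mem_orn_iff ⟨w, hw⟩ ⟨m w, (h.le_self w).trans_lt hw⟩).1
        ⟨le_rfl, h.le_self w⟩).1
    · have : (⟨δ.leftEnd w, (δ.leftEnd_le w).trans_lt hw⟩ : Fin n) ∈ δ.orn ⟨w, hw⟩ :=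
        (δ.mem_orn_iff _ _).2 ⟨le_rfl, δ.leftEnd_le w⟩
      exact this.1
  · rw [δ.leftEnd_of_le hw, h.eq_self w hw]

theorem range_leftEnd : Set.range (leftEnd (n := n)) = {m | IsBracketVector n m} :=
  Set.ext fun _ => ⟨fun ⟨δ, h⟩ => h ▸ δ.isBracketVector_leftEnd, exists_leftEnd_eq⟩

/-- Shortening a single nontrivial interval of `δ` gives an element covered by `δ`. -/
theorem covBy_of_leftEnd_eq_update {δ ε : Ornamentation (Fin n)} {v : ℕ} (hv : δ.leftEnd v < v)
    (hε : ε.leftEnd = Function.update δ.leftEnd v (popVector δ.leftEnd v)) : ε ⋖ δ := by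
  have hδ := δ.isBracketVector_leftEnd
  have hε' : ∀ w, w ≠ v → ε.leftEnd w = δ.leftEnd w := fun w hw => by
    rw [hε, Function.update_of_ne hw]
  have hεv : ε.leftEnd v = popVector δ.leftEnd v := by rw [hε, Function.update_self]
  have hlt := hδ.lt_popVector hv
  refine ⟨lt_of_le_not_ge (le_iff_leftEnd.2 fun w => ?_) fun h => ?_, fun σ h1 h2 => ?_⟩
  · rcases eq_or_ne w v with rfl | hw
    · omega
    · exact (hε' w hw).ge
  · have := le_iff_leftEnd.1 h v
    omega
  · have h1' := le_iff_leftEnd.1 h1.le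
    have h2' := le_iff_leftEnd.1 h2.le
    have heq : ∀ w, w ≠ v → δ.leftEnd w = σ.leftEnd w := fun w hw =>
      le_antisymm (h2' w) ((h1' w).trans (hε' w hw).le)
    -- Outside `v` all three vectors agree, so `σ` either equals `δ` or first differs from it at
    -- `v`, where it has already dropped to `ε` or below.
    by_cases hσ : δ.leftEnd v = σ.leftEnd v
    · refine h2.ne (leftEnd_injective (funext fun w => ?_))
      rcases eq_or_ne w v with rfl | hw
      · exact hσ.symm
      · exact (heq w hw).symm
    · have := hδ.popVector_le_of_first_ne σ.isBracketVector_leftEnd h2' hσ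
        fun w hw => heq w hw.ne
      refine h1.not_ge (le_iff_leftEnd.2 fun w => ?_)
      rcases eq_or_ne w v with rfl | hw
      · omega
      · rw [hε' w hw, heq w hw]

/-- Every element covered by `δ` arises by shortening a single interval. -/
theorem exists_leftEnd_eq_update_of_covBy {δ σ : Ornamentation (Fin n)} (h : σ ⋖ δ) :
    ∃ v, σ.leftEnd = Function.update δ.leftEnd v (popVector δ.leftEnd v) := by
  classical
  have hδ := δ.isBracketVector_leftEnd
  have hle := le_iff_leftEnd.1 h.le
  have hex : ∃ v, δ.leftEnd v ≠ σ.leftEnd v := by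
    by_contra! hcon
    exact h.ne (leftEnd_injective (funext hcon)).symm
  obtain ⟨v, hv, hmin⟩ : ∃ v, δ.leftEnd v ≠ σ.leftEnd v ∧ ∀ w < v, δ.leftEnd w = σ.leftEnd w :=
    ⟨Nat.find hex, Nat.find_spec hex, fun w hw => not_not.1 (Nat.find_min hex hw)⟩
  have hpop := hδ.popVector_le_of_first_ne σ.isBracketVector_leftEnd hle hv hmin
  -- Shortening `δ` only at the first difference `v` gives an element between `σ` and `δ`, which the
  -- covering relation forces to be `σ`.
  obtain ⟨ε, hε⟩ := exists_leftEnd_eq (hδ.update_popVector v)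
  have hv' : δ.leftEnd v < v :=
    (lt_of_le_of_ne (hle v) hv).trans_le (σ.leftEnd_le v)
  have hεδ := covBy_of_leftEnd_eq_update hv' hε
  have hσε : σ ≤ ε := le_iff_leftEnd.2 fun w => by
    rw [hε]
    rcases eq_or_ne w v with rfl | hw
    · simpa using hpop
    · simpa [hw] using hle w
  rcases hσε.eq_or_lt with rfl | hlt
  · exact ⟨v, hε⟩
  · exact absurd hεδ.lt (h.2 hlt)

end Ornamentation

theorem le_popStack_iff {L : Type*} [SemilatticeInf L] [Finite L] {x y : L} :
    y ≤ popStack x ↔ y ≤ x ∧ ∀ z, z ⋖ x → y ≤ z := by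
  unfold popStack
  exact (Finset.le_inf'_iff _ _).trans (by simp)

namespace Ornamentation

variable {n : ℕ}

/-- The shortening at `w` alone bounds the meet at `w`; conversely the simultaneous shortening lies
below every covered element, since each of these changes a single interval. -/
theorem leftEnd_popStack (δ : Ornamentation (Fin n)) :
    (popStack δ).leftEnd = popVector δ.leftEnd := by
  have hδ := δ.isBracketVector_leftEnd
  obtain ⟨ε, hε⟩ := exists_leftEnd_eq hδ.popVector
  rw [← hε]
  congr 1
  refine le_antisymm (le_iff_leftEnd.2 fun w => ?_) (le_popStack_iff.2 ⟨le_iff_leftEnd.2 fun w => ?_,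
    fun σ hσ => le_iff_leftEnd.2 fun w => ?_⟩)
  · have hpop := le_popStack_iff.1 (le_refl (popStack δ))
    rw [hε]
    rcases (hδ.le_self w).eq_or_lt with hw | hw
    · rw [popVector_of_eq hw]
      exact hw.ge.trans (le_iff_leftEnd.1 hpop.1 w)
    · obtain ⟨σ, hσ⟩ := exists_leftEnd_eq (hδ.update_popVector w)
      have := le_iff_leftEnd.1 (hpop.2 σ (covBy_of_leftEnd_eq_update hw hσ)) w
      rwa [hσ, Function.update_self] at this
  · rw [hε]
    exact hδ.le_popVector w
  · obtain ⟨v, hv⟩ := exists_leftEnd_eq_update_of_covBy hσ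
    rw [hε, hv]
    rcases eq_or_ne w v with rfl | hw
    · simp
    · simpa [hw] using hδ.le_popVector w

end Ornamentation

theorem popImageCard_eq_ncard (k n : ℕ) :
    popImageCard k n = (popVector^[k] '' {m | IsBracketVector n m}).ncard := by
  have hsemi : Function.Semiconj (Ornamentation.leftEnd (n := n)) popStack popVector :=
    Ornamentation.leftEnd_popStack
  rw [popImageCard, ← Set.ncard_image_of_injective _ Ornamentation.leftEnd_injective,
    ← Set.range_comp, (hsemi.iterate_right k).comp_eq, Set.range_comp, Ornamentation.range_leftEnd]

/-! ### The image of the iterated pop-stack operator -/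

/-- The bracket vectors in the image of the `k`-th iterate of the pop-stack operator (`1 ≤ k`): the
nontrivial intervals have distinct left ends, and each left end is the last of `k` consecutive
positions that carry trivial intervals and are different from `0`, except possibly the first. -/
structure IsPopImage (k n : ℕ) (m : ℕ → ℕ) : Prop extends IsBracketVector n m where
  inj : ∀ w w', m w < w → m w' < w' → m w = m w' → w = w'
  le_map : ∀ w, m w < w → k ≤ m w
  map_sub : ∀ w, m w < w → ∀ i < k, m (m w - i) = m w - i

theorem IsBracketVector.lt_of_popVector_lt {n : ℕ} {m : ℕ → ℕ} (h : IsBracketVector n m) {w : ℕ}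
    (hw : popVector m w < w) : m w < w :=
  (h.le_popVector w).trans_lt hw

theorem IsBracketVector.isPopImage_one_popVector {n : ℕ} {m : ℕ → ℕ} (h : IsBracketVector n m) :
    IsPopImage 1 n (popVector m) where
  toIsBracketVector := h.popVector
  inj := by
    have aux : ∀ w w', w < w' → popVector m w < w → popVector m w' < w' →
        popVector m w ≠ popVector m w' := by
      intro w w' hlt hw hw' heq
      obtain ⟨p, hp, hmp, hpw, -, -⟩ := h.exists_popVector_eq (h.lt_of_popVector_lt hw)
      obtain ⟨q, hq, -, -, -, hgr⟩ := h.exists_popVector_eq (h.lt_of_popVector_lt hw')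
      -- With a common new left end `q + 1`, the position `w` lies between `q` and `w'`, so its old
      -- left end exceeds `q = p`; yet that left end is at most `p`.
      have := hgr w (by omega) hlt
      omega
    intro w w' hw hw' heq
    rcases lt_trichotomy w w' with hlt | rfl | hlt
    · exact absurd heq (aux w w' hlt hw hw')
    · rfl
    · exact absurd heq.symm (aux w' w hlt hw' hw)
  le_map w hw := by
    obtain ⟨p, hp, -⟩ := h.exists_popVector_eq (h.lt_of_popVector_lt hw)
    omega
  map_sub w _ i hi := by
    obtain rfl : i = 0 := by omega
    exact h.popVector.map_map w

namespace IsPopImage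

variable {k n : ℕ} {m : ℕ → ℕ}

/-- By distinctness of left ends, the last earlier position sharing the left end `m w` can only be
the trivial position `m w` itself. -/
theorem popVector_eq_add_one (h : IsPopImage k n m) {w : ℕ} (hw : m w < w) :
    popVector m w = m w + 1 := by
  obtain ⟨p, hp, -, hpw, hmp, -⟩ := h.exists_popVector_eq hw
  rcases (h.le_self p).eq_or_lt with hpp | hpp
  · omega
  · exact absurd (h.inj p w hpp hw hmp) hpw.ne

protected theorem popVector (h : IsPopImage k n m) : IsPopImage (k + 1) n (popVector m) where
  toIsBracketVector := h.toIsBracketVector.popVector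
  inj := h.isPopImage_one_popVector.inj
  le_map w hw := by
    have hw' := h.lt_of_popVector_lt hw
    rw [h.popVector_eq_add_one hw']
    exact Nat.succ_le_succ (h.le_map w hw')
  map_sub w hw i hi := by
    have hw' := h.lt_of_popVector_lt hw
    rcases i with _ | i
    · exact h.toIsBracketVector.popVector.map_map w
    · rw [h.popVector_eq_add_one hw', Nat.add_sub_add_right]
      exact popVector_of_eq (h.map_sub w hw' i (by omega))

/-- In the image of a positive iterate, the positions after the left end `m w` and before `w`
carry intervals with a larger left end. -/
theorem lt_map_of_mem (h : IsPopImage k n m) {w x : ℕ} (hw : m w < w) (hx : m w < x)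
    (hxw : x < w) : m w < m x := by
  refine lt_of_le_of_ne (h.nested w x hx.le hxw.le) fun heq => ?_
  exact hxw.ne' (h.inj w x hw (heq ▸ hx) heq)

/-- Since popping now raises left ends by one, the preimage lowers each by one. The bound `2 ≤ k +
1` makes `m w - 1` a trivial position, which keeps the lowered intervals nested. -/
theorem exists_popVector_eq_of_pos (h : IsPopImage (k + 1) n m) (hk : 1 ≤ k) :
    ∃ l, IsPopImage k n l ∧ popVector l = m := by
  let l : ℕ → ℕ := fun w => if m w < w then m w - 1 else w
  have hlt : ∀ w, m w < w → l w = m w - 1 := fun w hw => if_pos hw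
  have heq : ∀ w, m w = w → l w = w := fun w hw => if_neg hw.not_lt
  have hpos : ∀ w, m w < w → 1 ≤ m w := fun w hw => by have := h.le_map w hw; omega
  have hlt' : ∀ w, l w < w → m w < w := fun w hw => by
    rcases (h.le_self w).eq_or_lt with h' | h'
    · exact absurd (heq w h') hw.ne
    · exact h'
  have hpred : ∀ w, m w < w → m (m w - 1) = m w - 1 := fun w hw => h.map_sub w hw 1 (by omega)
  have hl : IsPopImage k n l :=
    { le_self := fun w => by
        rcases (h.le_self w).eq_or_lt with hw | hw
        · exact (heq w hw).le
        · rw [hlt w hw]; omega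
      nested := fun w x hx hxw => by
        rcases (h.le_self w).eq_or_lt with hw | hw
        · rw [heq w hw] at hx
          rw [le_antisymm hx hxw]
        rw [hlt w hw] at hx ⊢
        rcases hx.eq_or_lt with rfl | hx
        · rw [heq _ (hpred w hw)]
        · have h1 := h.nested w x (by omega) hxw
          rcases (h.le_self x).eq_or_lt with hx' | hx'
          · rw [heq x hx']; omega
          · rw [hlt x hx']; omega
      eq_self := fun w hw => heq w (h.eq_self w hw)
      inj := fun w w' hw hw' he => by
        have h1 := hlt' w hw
        have h2 := hlt' w' hw'
        rw [hlt w h1, hlt w' h2] at he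
        have := hpos w h1
        have := hpos w' h2
        exact h.inj w w' h1 h2 (by omega)
      le_map := fun w hw => by
        have h1 := hlt' w hw
        have := h.le_map w h1
        rw [hlt w h1]
        omega
      map_sub := fun w hw i hi => by
        have h1 := hlt' w hw
        have := h.map_sub w h1 (i + 1) (by omega)
        rw [hlt w h1, show m w - 1 - i = m w - (i + 1) by omega]
        exact heq _ this }
  refine ⟨l, hl, funext fun w => ?_⟩
  rcases (h.le_self w).eq_or_lt with hw | hw
  · rw [popVector_of_eq (heq w hw), hw]
  · have := hpos w hw
    rw [hl.popVector_eq_add_one (by rw [hlt w hw]; omega), hlt w hw]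
    omega

end IsPopImage

/-- A preimage under the pop-stack operator: a nontrivial interval of `m` at `w` is extended by
the interval ending just before it. -/
def unpopVector (m : ℕ → ℕ) (w : ℕ) : ℕ :=
  if m w < w then unpopVector m (m w - 1) else w
termination_by w
decreasing_by omega

namespace IsPopImage

variable {k n : ℕ} {m : ℕ → ℕ}

/-- The recursion jumps from `y` to `m y - 1`, which is at least `a` as long as `y > a`, and it
stops at `a` because `a` is trivial. -/
theorem le_unpopVector {a : ℕ} (x : ℕ) (hx : a ≤ x) (h : ∀ y, a < y → y ≤ x → a < m y)
    (ha : m a = a) : a ≤ unpopVector m x := by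
  induction x using Nat.strong_induction_on with
  | _ x ih =>
    rw [unpopVector]
    split_ifs with hmx
    · have hne : a ≠ x := by rintro rfl; omega
      have := h x (by omega) le_rfl
      exact ih _ (by omega) (by omega) fun y h1 h2 => h y h1 (by omega)
    · exact hx

theorem exists_popVector_eq_of_one (h : IsPopImage 1 n m) :
    ∃ l, IsBracketVector n l ∧ popVector l = m := by
  have hlt : ∀ w, m w < w → unpopVector m w = unpopVector m (m w - 1) := fun w hw => by
    rw [unpopVector, if_pos hw]
  have heq : ∀ w, m w = w → unpopVector m w = w := fun w hw => by
    rw [unpopVector, if_neg hw.not_lt]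
  have hle : ∀ w, unpopVector m w ≤ w := by
    intro w
    induction w using Nat.strong_induction_on with
    | _ w ih =>
      rcases (h.le_self w).eq_or_lt with hw | hw
      · exact (heq w hw).le
      · rw [hlt w hw]
        exact (ih _ (by omega)).trans (by omega)
  have hge : ∀ w x, m w < w → m w ≤ x → x < w → m w ≤ unpopVector m x := fun w x hw hx hxw =>
    le_unpopVector x hx (fun y h1 h2 => h.lt_map_of_mem hw h1 (by omega)) (h.map_map w)
  refine ⟨unpopVector m, ⟨hle, fun w => ?_, fun w hw => heq w (h.eq_self w hw)⟩,
    funext fun w => ?_⟩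
  · induction w using Nat.strong_induction_on with
    | _ w ih =>
      intro x hx hxw
      rcases hxw.eq_or_lt with rfl | hxw
      · exact le_rfl
      rcases (h.le_self w).eq_or_lt with hw | hw
      · rw [heq w hw] at hx
        omega
      · have h1 := h.le_map w hw
        rw [hlt w hw] at hx ⊢
        rcases lt_or_ge x (m w) with hxm | hxm
        · exact ih _ (by omega) x hx (by omega)
        · have := hge w x hw hxm hxw
          have := hle (m w - 1)
          omega
  · rcases (h.le_self w).eq_or_lt with hw | hw
    · rw [popVector_of_eq (heq w hw), hw]
    · have h1 := h.le_map w hw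
      have h2 := hle (m w - 1)
      have h3 := hlt w hw
      -- By construction `m w - 1` shares its left end with `w`; positions from `m w` up to `w` have
      -- left end at least `m w`, so none of them does.
      rw [popVector_eq (p := m w - 1) (by omega) (by omega) h3.symm]
      · omega
      · intro x hx hxw
        have := hge w x hw (by omega) hxw
        omega

end IsPopImage

theorem image_iterate_popVector {k : ℕ} (hk : 1 ≤ k) (n : ℕ) :
    popVector^[k] '' {m | IsBracketVector n m} = {m | IsPopImage k n m} := by
  induction k, hk using Nat.le_induction with
  | base =>
    ext m
    constructor
    · rintro ⟨l, hl, rfl⟩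
      exact IsBracketVector.isPopImage_one_popVector hl
    · exact IsPopImage.exists_popVector_eq_of_one
  | succ k hk ih =>
    rw [Function.iterate_succ', Set.image_comp, ih]
    ext m
    constructor
    · rintro ⟨l, hl, rfl⟩
      exact IsPopImage.popVector hl
    · exact fun h => IsPopImage.exists_popVector_eq_of_pos h hk

/-! ### Generating trees -/

/-- `V n` is a set of sequences that are the identity from `n` on, and the sequences in `V (n + 1)`
arise from those in `V n` by choosing the value at `n` to be `n` or an element of `cand m n`. -/
structure IsGeneratingTree (V : ℕ → (ℕ → ℕ) → Prop) (cand : (ℕ → ℕ) → ℕ → Finset ℕ) : Prop where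
  zero : V 0 id
  eq_self : ∀ n m, V n m → ∀ i, n ≤ i → m i = i
  cand_lt : ∀ m n, ∀ a ∈ cand m n, a < n
  succ_iff : ∀ n m', V (n + 1) m' ↔
    ∃ m a, V n m ∧ (a = n ∨ a ∈ cand m n) ∧ m' = Function.update m n a

open Classical in
/-- The sequences obtained from `m` by choosing the values at `n, ..., n + r - 1`. -/
noncomputable def descendants (cand : (ℕ → ℕ) → ℕ → Finset ℕ) :
    ℕ → (ℕ → ℕ) → ℕ → Finset (ℕ → ℕ)
  | 0, m, _ => {m}
  | r + 1, m, n => (insert n (cand m n)).biUnion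
      fun a => descendants cand r (Function.update m n a) (n + 1)

namespace IsGeneratingTree

variable {V : ℕ → (ℕ → ℕ) → Prop} {cand : (ℕ → ℕ) → ℕ → Finset ℕ}

theorem eq_of_agree (h : IsGeneratingTree V cand) {n : ℕ} {m m' : ℕ → ℕ} (hm : V n m)
    (hm' : V n m') (hag : ∀ i < n, m' i = m i) : m' = m := by
  funext i
  rcases lt_or_ge i n with hi | hi
  · exact hag i hi
  · rw [h.eq_self n m hm i hi, h.eq_self n m' hm' i hi]

theorem exists_truncation (h : IsGeneratingTree V cand) {n r : ℕ} {m' : ℕ → ℕ}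
    (hm' : V (n + r) m') : ∃ m, V n m ∧ ∀ i < n, m' i = m i := by
  induction r generalizing m' with
  | zero => exact ⟨m', hm', fun _ _ => rfl⟩
  | succ r ih =>
    obtain ⟨m₁, a, h₁, -, rfl⟩ := (h.succ_iff (n + r) _).1 hm'
    obtain ⟨m, hm, hag⟩ := ih h₁
    exact ⟨m, hm, fun i hi => by
      rw [Function.update_of_ne (show i ≠ n + r by omega), hag i hi]⟩

theorem mem_descendants (h : IsGeneratingTree V cand) (r : ℕ) {n : ℕ} {m : ℕ → ℕ} (hm : V n m)
    (m' : ℕ → ℕ) : m' ∈ descendants cand r m n ↔ V (n + r) m' ∧ ∀ i < n, m' i = m i := by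
  induction r generalizing n m with
  | zero =>
    rw [descendants, Finset.mem_singleton, Nat.add_zero]
    exact ⟨fun he => ⟨he.symm ▸ hm, fun _ _ => by rw [he]⟩, fun ⟨h1, h2⟩ => h.eq_of_agree hm h1 h2⟩
  | succ r ih =>
    have hstep : ∀ a, a = n ∨ a ∈ cand m n → V (n + 1) (Function.update m n a) :=
      fun a ha => (h.succ_iff _ _).2 ⟨m, a, hm, ha, rfl⟩
    simp only [descendants, Finset.mem_biUnion, Finset.mem_insert]
    constructor
    · rintro ⟨a, ha, hmem⟩
      obtain ⟨h1, h2⟩ := (ih (hstep a ha)).1 hmem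
      refine ⟨by rwa [Nat.add_right_comm] at h1, fun i hi => ?_⟩
      rw [h2 i (by omega), Function.update_of_ne hi.ne]
    · rintro ⟨h1, h2⟩
      replace h1 : V (n + 1 + r) m' := by rwa [Nat.add_right_comm]
      obtain ⟨m₁, hm₁, hag⟩ := h.exists_truncation h1
      obtain ⟨m₂, a, hm₂, ha, rfl⟩ := (h.succ_iff _ _).1 hm₁
      obtain rfl : m₂ = m := h.eq_of_agree hm hm₂ fun i hi => by
        rw [← h2 i hi, hag i (by omega), Function.update_of_ne hi.ne]
      exact ⟨a, ha, (ih (hstep a ha)).2 ⟨h1, hag⟩⟩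

theorem card_descendants_succ (h : IsGeneratingTree V cand) (r : ℕ) {n : ℕ} {m : ℕ → ℕ}
    (hm : V n m) : (descendants cand (r + 1) m n).card =
      (descendants cand r m (n + 1)).card +
        ∑ a ∈ cand m n, (descendants cand r (Function.update m n a) (n + 1)).card := by
  classical
  rw [descendants, Finset.card_biUnion, Finset.sum_insert fun hn => (h.cand_lt m n n hn).false]
  · have : Function.update m n n = m := by
      rw [Function.update_eq_self_iff, h.eq_self n m hm n le_rfl]
    rw [this]
  · have hval : ∀ a ∈ insert n (cand m n), ∀ m' ∈ descendants cand r (Function.update m n a) (n + 1),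
        m' n = a := fun a ha m' hm' => by
      have hV : V (n + 1) (Function.update m n a) :=
        (h.succ_iff _ _).2 ⟨m, a, hm, Finset.mem_insert.1 ha, rfl⟩
      rw [((h.mem_descendants r hV m').1 hm').2 n (by omega), Function.update_self]
    exact fun a ha b hb hab => Finset.disjoint_left.2 fun m' h1 h2 =>
      hab ((hval a ha m' h1).symm.trans (hval b hb m' h2))

theorem ncard_eq (h : IsGeneratingTree V cand) (n : ℕ) :
    {m | V n m}.ncard = (descendants cand n id 0).card := by
  rw [← Set.ncard_coe_finset]
  congr 1
  ext m
  simp [h.mem_descendants n h.zero]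

end IsGeneratingTree

/-! ### Counting all bracket vectors -/

/-- The ranks of the elements of `s` run through `0, ..., s.card - 1`. A choice of left end
influences the later count only through its rank among the candidates. -/
theorem Finset.sum_card_filter_lt {M : Type*} [AddCommMonoid M] (s : Finset ℕ) (f : ℕ → M) :
    ∑ a ∈ s, f (s.filter (· < a)).card = ∑ j ∈ Finset.range s.card, f j := by
  induction s using Finset.induction_on_max with
  | empty => simp
  | insert a s hs ih =>
    have ha : a ∉ s := fun h => (hs a h).false
    rw [Finset.sum_insert ha, Finset.card_insert_of_notMem ha, Finset.sum_range_succ, ← ih,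
      add_comm]
    congr 1
    · refine Finset.sum_congr rfl fun b hb => ?_
      rw [Finset.filter_insert, if_neg (hs b hb).not_gt]
    · rw [Finset.filter_insert, if_neg (lt_irrefl a), Finset.filter_true_of_mem hs]

open Classical in
/-- The values below `n` that a bracket vector may take at `n`. -/
noncomputable def leftEndCandidates (m : ℕ → ℕ) (n : ℕ) : Finset ℕ :=
  (Finset.range n).filter fun a => ∀ x, a ≤ x → x < n → a ≤ m x

theorem mem_leftEndCandidates {m : ℕ → ℕ} {n a : ℕ} :
    a ∈ leftEndCandidates m n ↔ a < n ∧ ∀ x, a ≤ x → x < n → a ≤ m x := by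
  simp [leftEndCandidates]

theorem isBracketVector_id (n : ℕ) : IsBracketVector n id :=
  ⟨fun _ => le_rfl, fun _ _ h _ => h, fun _ _ => rfl⟩

theorem IsBracketVector.succ {n : ℕ} {m : ℕ → ℕ} (h : IsBracketVector n m) :
    IsBracketVector (n + 1) m :=
  { h with eq_self := fun w hw => h.eq_self w (by omega) }

theorem IsBracketVector.update_self {n : ℕ} {m : ℕ → ℕ} (h : IsBracketVector (n + 1) m) :
    IsBracketVector n (Function.update m n n) where
  le_self w := by
    rcases eq_or_ne w n with rfl | hw
    · simp
    · simpa [hw] using h.le_self w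
  nested w x hx hxw := by
    rcases eq_or_ne x n with rfl | hxn
    · simpa using (hx.trans (by simp))
    rcases eq_or_ne w n with rfl | hwn
    · simp at hx
      omega
    · simp only [Function.update_of_ne hwn, Function.update_of_ne hxn] at hx ⊢
      exact h.nested w x hx hxw
  eq_self w hw := by
    rcases eq_or_ne w n with rfl | hwn
    · simp
    · rw [Function.update_of_ne hwn]
      exact h.eq_self w (by omega)

theorem IsBracketVector.update {n a : ℕ} {m : ℕ → ℕ} (h : IsBracketVector n m) (ha : a ≤ n)
    (hx : ∀ x, a ≤ x → x < n → a ≤ m x) : IsBracketVector (n + 1) (Function.update m n a) where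
  le_self w := by
    rcases eq_or_ne w n with rfl | hw
    · simpa
    · simpa [hw] using h.le_self w
  nested w x hxl hxw := by
    rcases hxw.eq_or_lt with rfl | hlt
    · exact le_rfl
    rcases eq_or_ne w n with rfl | hwn
    · rw [Function.update_self] at hxl ⊢
      rw [Function.update_of_ne hlt.ne]
      exact hx x hxl hlt
    · rw [Function.update_of_ne hwn] at hxl ⊢
      rcases eq_or_ne x n with rfl | hxn
      · have := h.eq_self w hlt.le
        omega
      · rw [Function.update_of_ne hxn]
        exact h.nested w x hxl hxw
  eq_self w hw := by
    rw [Function.update_of_ne (by omega)]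
    exact h.eq_self w (by omega)

theorem isGeneratingTree_isBracketVector :
    IsGeneratingTree IsBracketVector leftEndCandidates where
  zero := isBracketVector_id 0
  eq_self _ _ h := h.eq_self
  cand_lt _ _ _ ha := (mem_leftEndCandidates.1 ha).1
  succ_iff n m' := by
    constructor
    · intro h
      refine ⟨Function.update m' n n, m' n, h.update_self, ?_, by simp⟩
      rcases (h.le_self n).eq_or_lt with hn | hn
      · exact Or.inl hn
      · refine Or.inr (mem_leftEndCandidates.2 ⟨hn, fun x h1 h2 => ?_⟩)
        rw [Function.update_of_ne h2.ne]
        exact h.nested n x h1 h2.le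
    · rintro ⟨m, a, hm, rfl | ha, rfl⟩
      · exact hm.update le_rfl fun x h1 h2 => by omega
      · rw [mem_leftEndCandidates] at ha
        exact hm.update ha.1.le ha.2

theorem leftEndCandidates_succ {m : ℕ → ℕ} {n : ℕ} (h : m n = n) :
    leftEndCandidates m (n + 1) = insert n (leftEndCandidates m n) := by
  ext b
  simp only [Finset.mem_insert, mem_leftEndCandidates]
  constructor
  · rintro ⟨h1, h2⟩
    rcases eq_or_ne b n with hb | hb
    · exact Or.inl hb
    · exact Or.inr ⟨by omega, fun x h3 h4 => h2 x h3 (by omega)⟩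
  · rintro (rfl | ⟨h1, h2⟩)
    · refine ⟨by omega, fun x h3 h4 => ?_⟩
      obtain rfl : x = b := by omega
      exact h.ge
    · refine ⟨by omega, fun x h3 h4 => ?_⟩
      rcases eq_or_ne x n with rfl | hx
      · omega
      · exact h2 x h3 (by omega)

/-- The new interval `[a, n]` blocks the candidates inside it other than `a`, and also `n` itself;
its own left end may be reused. -/
theorem leftEndCandidates_update {m : ℕ → ℕ} {n a : ℕ} (ha : a ∈ leftEndCandidates m n) :
    leftEndCandidates (Function.update m n a) (n + 1) =
      insert a ((leftEndCandidates m n).filter (· < a)) := by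
  have hlt := (mem_leftEndCandidates.1 ha).1
  ext b
  simp only [Finset.mem_insert, Finset.mem_filter]
  constructor
  · intro hb
    rw [mem_leftEndCandidates] at hb
    have hba := hb.2 n (by omega) (by omega)
    rw [Function.update_self] at hba
    rcases hba.eq_or_lt with h | h
    · exact Or.inl h
    · refine Or.inr ⟨mem_leftEndCandidates.2 ⟨by omega, fun x h1 h2 => ?_⟩, h⟩
      simpa [h2.ne] using hb.2 x h1 (by omega)
  · intro hb
    have hb' : b ∈ leftEndCandidates m n ∧ b ≤ a := by
      rcases hb with rfl | ⟨h1, h2⟩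
      · exact ⟨ha, le_rfl⟩
      · exact ⟨h1, h2.le⟩
    rw [mem_leftEndCandidates] at hb' ⊢
    refine ⟨by omega, fun x h1 h2 => ?_⟩
    rcases eq_or_ne x n with rfl | hx
    · simpa using hb'.2
    · simpa [hx] using hb'.1.2 x h1 (by omega)

theorem card_descendants_leftEndCandidates {F : ℚ⟦X⟧} (hF : F = 1 + PowerSeries.X * F ^ 2) (r : ℕ)
    {n : ℕ} {m : ℕ → ℕ} (hm : IsBracketVector n m) :
    ((descendants leftEndCandidates r m n).card : ℚ) =
      PowerSeries.coeff r (F ^ ((leftEndCandidates m n).card + 1)) := by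
  induction r generalizing n m with
  | zero =>
    have hc : PowerSeries.constantCoeff F = 1 := by rw [hF]; simp
    simp [descendants, hc]
  | succ r ih =>
    have htree := isGeneratingTree_isBracketVector
    have hnot : n ∉ leftEndCandidates m n := fun h => (htree.cand_lt _ _ _ h).false
    have hsum : ∑ a ∈ leftEndCandidates m n,
        ((descendants leftEndCandidates r (Function.update m n a) (n + 1)).card : ℚ) =
        ∑ j ∈ Finset.range (leftEndCandidates m n).card, PowerSeries.coeff r (F ^ (j + 1 + 1)) := by
      rw [← Finset.sum_card_filter_lt]
      refine Finset.sum_congr rfl fun a ha => ?_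
      rw [ih ((htree.succ_iff n _).2 ⟨m, a, hm, Or.inr ha, rfl⟩), leftEndCandidates_update ha,
        Finset.card_insert_of_notMem (by simp)]
    rw [htree.card_descendants_succ r hm, Nat.cast_add, Nat.cast_sum, hsum, ih hm.succ,
      leftEndCandidates_succ (hm.eq_self n le_rfl), Finset.card_insert_of_notMem hnot, ← map_sum,
      ← map_add, ← PowerSeries.coeff_succ_X_mul]
    generalize (leftEndCandidates m n).card = h
    -- A trivial choice leaves `h + 1` candidates, the candidate of rank `j` leaves `j + 1`. The
    -- identity is the geometric sum for `F ^ (h + 1) - 1` with `F - 1 = X F ^ 2`.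
    have hrec : F ^ (h + 1) = 1 + PowerSeries.X *
        (F ^ (h + 1 + 1) + ∑ j ∈ Finset.range h, F ^ (j + 1 + 1)) := by
      have hg : (∑ j ∈ Finset.range h, F ^ j) * (F - 1) = F ^ h - 1 := geom_sum_mul F h
      have h1 : ∑ j ∈ Finset.range h, F ^ (j + 1 + 1) = F ^ 2 * ∑ j ∈ Finset.range h, F ^ j := by
        rw [Finset.mul_sum]
        exact Finset.sum_congr rfl fun j _ => by ring
      rw [h1]
      linear_combination -hg + (F ^ h + ∑ j ∈ Finset.range h, F ^ j) * hF
    rw [hrec]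
    simp [PowerSeries.coeff_one]

theorem popImageCard_zero_left {F : ℚ⟦X⟧} (hF : F = 1 + PowerSeries.X * F ^ 2) (n : ℕ) :
    (popImageCard 0 n : ℚ) = PowerSeries.coeff n F := by
  rw [popImageCard_eq_ncard, Function.iterate_zero, Set.image_id,
    isGeneratingTree_isBracketVector.ncard_eq,
    card_descendants_leftEndCandidates hF n (isBracketVector_id 0)]
  simp [leftEndCandidates]

/-! ### Counting the image of a positive iterate -/

/-- The position `a` is the last of `k` consecutive positions carrying trivial intervals, and at
least `k` positions precede it. -/
def IsEligible (k : ℕ) (m : ℕ → ℕ) (a : ℕ) : Prop :=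
  k ≤ a ∧ ∀ i < k, m (a - i) = a - i

theorem IsEligible.congr {k a : ℕ} {m m' : ℕ → ℕ} (h : IsEligible k m a)
    (hm : ∀ i ≤ a, m' i = m i) : IsEligible k m' a :=
  ⟨h.1, fun i hi => (hm _ (by omega)).trans (h.2 i hi)⟩

open Classical in
/-- The values below `n` that a sequence satisfying `IsPopImage k` may take at `n`. -/
noncomputable def openCandidates (k : ℕ) (m : ℕ → ℕ) (n : ℕ) : Finset ℕ :=
  (Finset.range n).filter fun a => IsEligible k m a ∧ ∀ x, a < x → x < n → a < m x

theorem mem_openCandidates {k : ℕ} {m : ℕ → ℕ} {n a : ℕ} :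
    a ∈ openCandidates k m n ↔ a < n ∧ IsEligible k m a ∧ ∀ x, a < x → x < n → a < m x := by
  simp [openCandidates]

theorem isPopImage_id (k n : ℕ) : IsPopImage k n id where
  toIsBracketVector := isBracketVector_id n
  inj w _ h := absurd h (lt_irrefl w)
  le_map w h := absurd h (lt_irrefl w)
  map_sub w h := absurd h (lt_irrefl w)

theorem IsPopImage.succ {k n : ℕ} {m : ℕ → ℕ} (h : IsPopImage k n m) : IsPopImage k (n + 1) m :=
  { h with toIsBracketVector := h.toIsBracketVector.succ }

theorem IsPopImage.isEligible {k n : ℕ} {m : ℕ → ℕ} (h : IsPopImage k n m) {w : ℕ}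
    (hw : m w < w) : IsEligible k m (m w) :=
  ⟨h.le_map w hw, h.map_sub w hw⟩

theorem IsBracketVector.isPopImage {k n : ℕ} {m : ℕ → ℕ} (h : IsBracketVector n m)
    (hinj : ∀ w w', m w < w → m w' < w' → m w = m w' → w = w')
    (hel : ∀ w, m w < w → IsEligible k m (m w)) : IsPopImage k n m where
  toIsBracketVector := h
  inj := hinj
  le_map w hw := (hel w hw).1
  map_sub w hw := (hel w hw).2

theorem isGeneratingTree_isPopImage {k : ℕ} (hk : 1 ≤ k) :
    IsGeneratingTree (IsPopImage k) (openCandidates k) where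
  zero := isPopImage_id k 0
  eq_self _ _ h := h.eq_self
  cand_lt _ _ _ ha := (mem_openCandidates.1 ha).1
  succ_iff n m' := by
    constructor
    · intro h
      have hne : ∀ w, Function.update m' n n w < w → w ≠ n := by
        rintro w hw rfl
        simp at hw
      refine ⟨Function.update m' n n, m' n, h.update_self.isPopImage (fun w w' hw hw' => ?_)
        (fun w hw => ?_), ?_, by simp⟩
      · have h1 := hne w hw
        have h2 := hne w' hw'
        rw [Function.update_of_ne h1] at hw ⊢
        rw [Function.update_of_ne h2] at hw' ⊢
        exact h.inj w w' hw hw'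
      · have h1 := hne w hw
        rw [Function.update_of_ne h1] at hw ⊢
        have := h.lt_of_lt_self hw
        exact (h.isEligible hw).congr fun i hi => Function.update_of_ne (by omega) _ _
      · rcases (h.le_self n).eq_or_lt with hn | hn
        · exact Or.inl hn
        · refine Or.inr (mem_openCandidates.2 ⟨hn, (h.isEligible hn).congr fun i hi =>
            Function.update_of_ne (by omega) _ _, fun x h1 h2 => ?_⟩)
          rw [Function.update_of_ne h2.ne]
          exact h.lt_map_of_mem hn h1 h2
    · rintro ⟨m, a, hm, rfl | ha, rfl⟩
      · rw [Function.update_eq_self_iff.2 (hm.eq_self a le_rfl).symm]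
        exact hm.succ
      · obtain ⟨h1, h2, h3⟩ := mem_openCandidates.1 ha
        have hb : IsBracketVector (n + 1) (Function.update m n a) := by
          refine hm.update h1.le fun x hx hxn => ?_
          rcases hx.eq_or_lt with rfl | hx
          · exact (h2.2 0 (by omega)).ge
          · exact (h3 x hx hxn).le
        have hlt : ∀ w, Function.update m n a w < w → w ≠ n → w < n := fun w hw hwn => by
          have := hb.lt_of_lt_self hw
          omega
        have hne : ∀ w, m w < w → w < n → m w ≠ a := fun w hw hwn he => by
          have := h3 w (by omega) hwn
          omega
        refine hb.isPopImage (fun w w' hw hw' he => ?_) (fun w hw => ?_)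
        · by_cases h4 : w = n <;> by_cases h5 : w' = n
          · rw [h4, h5]
          · have h6 := hlt w' hw' h5
            rw [Function.update_of_ne h5] at hw' he
            rw [h4, Function.update_self] at he
            exact absurd he.symm (hne w' hw' h6)
          · have h6 := hlt w hw h4
            rw [Function.update_of_ne h4] at hw he
            rw [h5, Function.update_self] at he
            exact absurd he (hne w hw h6)
          · rw [Function.update_of_ne h4] at hw he
            rw [Function.update_of_ne h5] at hw' he
            exact hm.inj w w' hw hw' he
        · by_cases h4 : w = n
          · subst h4
            rw [Function.update_self]
            exact h2.congr fun i hi => Function.update_of_ne (by omega) _ _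
          · have h5 := hlt w hw h4
            rw [Function.update_of_ne h4] at hw ⊢
            exact (hm.isEligible hw).congr fun i hi => Function.update_of_ne (by omega) _ _

theorem openCandidates_succ_of_isEligible {k : ℕ} {m : ℕ → ℕ} {n : ℕ} (h : m n = n)
    (hn : IsEligible k m n) :
    openCandidates k m (n + 1) = insert n (openCandidates k m n) := by
  ext b
  simp only [Finset.mem_insert, mem_openCandidates]
  constructor
  · rintro ⟨h1, h2, h3⟩
    rcases eq_or_ne b n with hb | hb
    · exact Or.inl hb
    · exact Or.inr ⟨by omega, h2, fun x h4 h5 => h3 x h4 (by omega)⟩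
  · rintro (rfl | ⟨h1, h2, h3⟩)
    · exact ⟨by omega, hn, fun x h3 h4 => by omega⟩
    · refine ⟨by omega, h2, fun x h4 h5 => ?_⟩
      rcases eq_or_ne x n with rfl | hx
      · omega
      · exact h3 x h4 (by omega)

theorem openCandidates_succ_of_not_isEligible {k : ℕ} {m : ℕ → ℕ} {n : ℕ} (h : m n = n)
    (hn : ¬ IsEligible k m n) :
    openCandidates k m (n + 1) = openCandidates k m n := by
  ext b
  simp only [mem_openCandidates]
  constructor
  · rintro ⟨h1, h2, h3⟩
    have hb : b ≠ n := fun hb => hn (hb ▸ h2)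
    exact ⟨by omega, h2, fun x h4 h5 => h3 x h4 (by omega)⟩
  · rintro ⟨h1, h2, h3⟩
    refine ⟨by omega, h2, fun x h4 h5 => ?_⟩
    rcases eq_or_ne x n with rfl | hx
    · omega
    · exact h3 x h4 (by omega)

/-- Unlike for general bracket vectors, `a` itself is used up, because left ends of nontrivial
intervals must be distinct. -/
theorem openCandidates_update {k : ℕ} (hk : 1 ≤ k) {m : ℕ → ℕ} {n a : ℕ}
    (ha : a ∈ openCandidates k m n) :
    openCandidates k (Function.update m n a) (n + 1) =
      (openCandidates k m n).filter (· < a) := by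
  have hlt := (mem_openCandidates.1 ha).1
  ext b
  simp only [Finset.mem_filter, mem_openCandidates]
  constructor
  · rintro ⟨h1, h2, h3⟩
    have hbn : b ≠ n := by
      rintro rfl
      have := h2.2 0 (by omega)
      simp at this
      omega
    have hba := h3 n (by omega) (by omega)
    rw [Function.update_self] at hba
    refine ⟨⟨by omega, h2.congr fun i hi => (Function.update_of_ne (by omega) _ _).symm,
      fun x h4 h5 => ?_⟩, hba⟩
    simpa [h5.ne] using h3 x h4 (by omega)
  · rintro ⟨⟨h1, h2, h3⟩, hba⟩
    refine ⟨by omega, h2.congr fun i hi => Function.update_of_ne (by omega) _ _,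
      fun x h4 h5 => ?_⟩
    rcases eq_or_ne x n with rfl | hx
    · simpa using hba
    · simpa [hx] using h3 x h4 (by omega)

/-- A nontrivial interval ending at `n` resets the waiting time: the window of `k` positions ending
at `n + 1 + d` must avoid `n`. -/
theorem isEligible_update_iff {k n a : ℕ} {m : ℕ → ℕ} (hm : ∀ i, n ≤ i → m i = i)
    (ha : a < n) (hka : k ≤ a) (d : ℕ) :
    IsEligible k (Function.update m n a) (n + 1 + d) ↔ k - 1 ≤ d := by
  constructor
  · rintro ⟨-, h⟩
    by_contra hd
    have := h (d + 1) (by omega)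
    rw [show n + 1 + d - (d + 1) = n by omega, Function.update_self] at this
    omega
  · intro hd
    refine ⟨by omega, fun i hi => ?_⟩
    rw [Function.update_of_ne (by omega)]
    exact hm _ (by omega)

/-- Here `c` is the number of further positions that have to carry trivial intervals before a
position becomes eligible. -/
theorem card_descendants_openCandidates {k : ℕ} (hk : 1 ≤ k) {R : ℕ → ℚ⟦X⟧}
    (hR : R 0 = 1 + PowerSeries.X * R k * R 0) (hR' : ∀ c, R (c + 1) = 1 + PowerSeries.X * R c)
    (r : ℕ) {n c : ℕ} {m : ℕ → ℕ} (hm : IsPopImage k n m)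
    (hc : ∀ d, IsEligible k m (n + d) ↔ c ≤ d) :
    ((descendants (openCandidates k) r m n).card : ℚ) =
      PowerSeries.coeff r (R c * R k ^ (openCandidates k m n).card) := by
  induction r generalizing n c m with
  | zero =>
    have h0 : ∀ c, PowerSeries.constantCoeff (R c) = 1 := by
      rintro (_ | c)
      · rw [hR]; simp
      · rw [hR']; simp
    simp [descendants, h0]
  | succ r ih =>
    have htree := isGeneratingTree_isPopImage hk
    have hnn := hm.eq_self n le_rfl
    have hnot : n ∉ openCandidates k m n := fun h => (htree.cand_lt _ _ _ h).false
    have hsum : ∑ a ∈ openCandidates k m n,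
        ((descendants (openCandidates k) r (Function.update m n a) (n + 1)).card : ℚ) =
        ∑ j ∈ Finset.range (openCandidates k m n).card,
          PowerSeries.coeff r (R (k - 1) * R k ^ j) := by
      rw [← Finset.sum_card_filter_lt]
      refine Finset.sum_congr rfl fun a ha => ?_
      have ha' := mem_openCandidates.1 ha
      rw [ih ((htree.succ_iff n _).2 ⟨m, a, hm, Or.inr ha, rfl⟩)
        (isEligible_update_iff hm.eq_self ha'.1 ha'.2.1.1), openCandidates_update hk ha]
    have hRk : R k = 1 + PowerSeries.X * R (k - 1) := by
      rw [← hR', Nat.sub_add_cancel hk]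
    -- All nontrivial choices together contribute a geometric sum, which telescopes because `X * R
    -- (k - 1) = R k - 1`.
    have hgeom : ∀ h : ℕ, PowerSeries.X * ∑ j ∈ Finset.range h, R (k - 1) * R k ^ j =
        R k ^ h - 1 := fun h => by
      rw [← geom_sum_mul, ← Finset.mul_sum]
      linear_combination (-∑ j ∈ Finset.range h, R k ^ j) * hRk
    -- After a trivial position the waiting time drops by one; truncated subtraction keeps it at `0`
    -- once it is there.
    have hshift : ∀ d, IsEligible k m (n + 1 + d) ↔ c - 1 ≤ d := fun d => by
      rw [add_assoc, hc]
      omega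
    rw [htree.card_descendants_succ r hm, Nat.cast_add, Nat.cast_sum, hsum, ih hm.succ hshift,
      ← map_sum, ← map_add, ← PowerSeries.coeff_succ_X_mul, mul_add, hgeom]
    have hel : IsEligible k m n ↔ c = 0 := by simpa using hc 0
    rcases c with _ | c
    · rw [openCandidates_succ_of_isEligible hnn (hel.2 rfl), Finset.card_insert_of_notMem hnot]
      generalize (openCandidates k m n).card = h
      have hrec : R 0 * R k ^ h =
          1 + (PowerSeries.X * (R 0 * R k ^ (h + 1)) + (R k ^ h - 1)) := by
        linear_combination R k ^ h * hR
      rw [hrec]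
      simp [PowerSeries.coeff_one]
    · rw [openCandidates_succ_of_not_isEligible hnn fun h => by simpa using hel.1 h]
      generalize (openCandidates k m n).card = h
      have hrec : R (c + 1) * R k ^ h =
          1 + (PowerSeries.X * (R c * R k ^ h) + (R k ^ h - 1)) := by
        linear_combination R k ^ h * hR' c
      rw [hrec]
      simp [PowerSeries.coeff_one]

/-- The empty vector has no candidates, and the first eligible position is `k`, so the count starts
with `c = k` and `h = 0`. -/
theorem popImageCard_of_pos {k : ℕ} (hk : 1 ≤ k) {R : ℕ → ℚ⟦X⟧}
    (hR : R 0 = 1 + PowerSeries.X * R k * R 0) (hR' : ∀ c, R (c + 1) = 1 + PowerSeries.X * R c)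
    (n : ℕ) : (popImageCard k n : ℚ) = PowerSeries.coeff n (R k) := by
  rw [popImageCard_eq_ncard, image_iterate_popVector hk, (isGeneratingTree_isPopImage hk).ncard_eq,
    card_descendants_openCandidates hk hR hR' n (c := k) (isPopImage_id k 0)]
  · simp [openCandidates]
  · intro d
    simp [IsEligible]

/-! ### Solving the functional equations -/

namespace PowerSeries

theorem map_catalanSeries_eq : map (Nat.castRingHom ℚ) catalanSeries =
    1 + X * map (Nat.castRingHom ℚ) catalanSeries ^ 2 := by
  conv_lhs => rw [← catalanSeries_sq_mul_X_add_one]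
  simp only [map_add, map_mul, map_pow, map_one, map_X]
  ring

/-- Substitute `g` into the Catalan series, which solves the case `g = X`. -/
theorem exists_eq_one_add_mul_sq (g : ℚ⟦X⟧) (hg : constantCoeff g = 0) :
    ∃ F : ℚ⟦X⟧, F = 1 + g * F ^ 2 := by
  have hs : HasSubst g := HasSubst.of_constantCoeff_zero' hg
  refine ⟨subst g (map (Nat.castRingHom ℚ) catalanSeries), ?_⟩
  have := congrArg (substAlgHom hs) map_catalanSeries_eq
  simpa only [map_add, map_mul, map_pow, map_one, substAlgHom_X, coe_substAlgHom] using this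

theorem exists_quadratic (k : ℕ) :
    ∃ F : ℚ⟦X⟧, (1 - X ^ (k + 1)) * (F - 1) = X * (1 - X) * F ^ 2 := by
  obtain ⟨F, hF⟩ := exists_eq_one_add_mul_sq (X * (1 - X) * (1 - X ^ (k + 1))⁻¹) (by simp)
  have hinv : (1 - X ^ (k + 1) : ℚ⟦X⟧) * (1 - X ^ (k + 1))⁻¹ = 1 :=
    PowerSeries.mul_inv_cancel _ (by simp)
  refine ⟨F, ?_⟩
  linear_combination (1 - X ^ (k + 1)) * hF + X * (1 - X) * F ^ 2 * hinv

end PowerSeries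

open PowerSeries in
/-- The series counting the sequences whose first `c` positions must be trivial. -/
noncomputable def restrictedSeries (F : ℚ⟦X⟧) : ℕ → ℚ⟦X⟧
  | 0 => (1 - X * F)⁻¹
  | c + 1 => 1 + X * restrictedSeries F c

open PowerSeries in
theorem restrictedSeries_zero_mul (F : ℚ⟦X⟧) : restrictedSeries F 0 * (1 - X * F) = 1 :=
  PowerSeries.inv_mul_cancel _ (by simp)

open PowerSeries in
theorem one_sub_X_mul_restrictedSeries (F : ℚ⟦X⟧) (c : ℕ) :
    (1 - X) * restrictedSeries F c = 1 - X ^ c + X ^ c * (1 - X) * restrictedSeries F 0 := by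
  induction c with
  | zero => simp
  | succ c ih =>
    rw [show restrictedSeries F (c + 1) = 1 + X * restrictedSeries F c from rfl]
    linear_combination X * ih

open PowerSeries in
-- Unrolling the recursion expresses `R k` through `X` and `(1 - X F)⁻¹`; after clearing
-- denominators, equality with `F` is exactly the quadratic equation. Thus the system that defines
-- `R` from `F` closes up with `R k = F`.
theorem restrictedSeries_eq {k : ℕ} {F : ℚ⟦X⟧}
    (hF : (1 - X ^ (k + 1)) * (F - 1) = X * (1 - X) * F ^ 2) : restrictedSeries F k = F := by
  have h1 : (1 - X : ℚ⟦X⟧) ≠ 0 := fun h => by simpa using congrArg constantCoeff h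
  have h2 : (1 - X * F : ℚ⟦X⟧) ≠ 0 := fun h => by simpa using congrArg constantCoeff h
  refine mul_left_cancel₀ (mul_ne_zero h2 h1) ?_
  linear_combination (1 - X * F) * one_sub_X_mul_restrictedSeries F k +
    X ^ k * (1 - X) * restrictedSeries_zero_mul F - hF

open PowerSeries in
theorem popImageCard_eq_coeff {k : ℕ} {F : ℚ⟦X⟧}
    (hF : (1 - X ^ (k + 1)) * (F - 1) = X * (1 - X) * F ^ 2) (n : ℕ) :
    (popImageCard k n : ℚ) = coeff n F := by
  rcases Nat.eq_zero_or_pos k with rfl | hk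
  · refine popImageCard_zero_left ?_ n
    have h1 : (1 - X : ℚ⟦X⟧) ≠ 0 := fun h => by simpa using congrArg constantCoeff h
    exact mul_left_cancel₀ h1 (by linear_combination hF)
  · have hRk := restrictedSeries_eq hF
    rw [popImageCard_of_pos hk (R := restrictedSeries F) ?_ (fun _ => rfl), hRk]
    rw [hRk]
    linear_combination restrictedSeries_zero_mul F

/-! ### Catalan numbers, Motzkin numbers and the closed form -/

open PowerSeries in
theorem popImageCard_zero_eq_catalan (n : ℕ) : popImageCard 0 n = catalan n := by
  have := popImageCard_zero_left map_catalanSeries_eq n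
  rw [coeff_map, catalanSeries_coeff, eq_natCast] at this
  exact_mod_cast this

open PowerSeries in
theorem coeff_eq_motzkin {M : ℚ⟦X⟧} (hM : M = 1 + X * M + X ^ 2 * M ^ 2) (n : ℕ) :
    coeff n M = motzkin n := by
  induction n using Nat.strong_induction_on with
  | _ n ih =>
    rcases n with _ | n
    · rw [hM]
      simp [motzkin]
    · have h1 : coeff (n + 1) M = coeff n M + coeff n (X * M ^ 2) := by
        conv_lhs => rw [hM, show 1 + X * M + X ^ 2 * M ^ 2 = 1 + X * (M + X * M ^ 2) by ring]
        rw [map_add, coeff_succ_X_mul, map_add]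
        simp [coeff_one]
      rw [h1, ih n (by omega), motzkin, Nat.cast_add, Nat.cast_sum]
      congr 1
      rcases n with _ | n
      · simp
      · rw [coeff_succ_X_mul, pow_two, coeff_mul,
          Finset.Nat.sum_antidiagonal_eq_sum_range_succ (fun i j => coeff i M * coeff j M),
          Finset.sum_range]
        refine Finset.sum_congr rfl fun i _ => ?_
        rw [ih i (by omega), ih (n - i) (by omega), Nat.cast_mul, Nat.add_sub_cancel]

open PowerSeries in
theorem popImageCard_one_eq_motzkin :
    popImageCard 1 0 = 1 ∧ ∀ n, popImageCard 1 (n + 1) = motzkin n := by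
  obtain ⟨F, hF⟩ := exists_quadratic 1
  have hFR : F = 1 + X * restrictedSeries F 0 := (restrictedSeries_eq hF).symm
  -- For `k = 1`, inserting `F = 1 + X R` into `R (1 - X F) = 1` yields the Motzkin equation for
  -- `R`; the factor `X` in `F` explains the index shift.
  have hM : restrictedSeries F 0 =
      1 + X * restrictedSeries F 0 + X ^ 2 * restrictedSeries F 0 ^ 2 := by
    linear_combination restrictedSeries_zero_mul F + X * restrictedSeries F 0 * hFR
  refine ⟨?_, fun n => ?_⟩
  · have := popImageCard_eq_coeff hF 0
    rw [hFR] at this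
    simp at this
    exact_mod_cast this
  · have := popImageCard_eq_coeff hF (n + 1)
    rw [hFR, map_add, coeff_succ_X_mul, coeff_eq_motzkin hM] at this
    simp [coeff_one] at this
    exact_mod_cast this

theorem theorem1p3 :
    (∀ k : ℕ, ∃ S : ℚ⟦X⟧,
      PowerSeries.constantCoeff S = 1 ∧
      S ^ 2 = (1 - PowerSeries.X ^ (k + 1)) ^ 2
        - 4 * PowerSeries.X * (1 - PowerSeries.X) * (1 - PowerSeries.X ^ (k + 1)) ∧
      ((PowerSeries.mk fun n => (popImageCard k n : ℚ) : ℚ⟦X⟧) : LaurentSeries ℚ) =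
        ((1 - PowerSeries.X ^ (k + 1) - S : ℚ⟦X⟧) : LaurentSeries ℚ) /
          ((2 * PowerSeries.X * (1 - PowerSeries.X) : ℚ⟦X⟧) : LaurentSeries ℚ)) ∧
    (∀ n : ℕ, popImageCard 0 n = catalan n) ∧
    (popImageCard 1 0 = 1 ∧ ∀ n : ℕ, popImageCard 1 (n + 1) = motzkin n) := by
  refine ⟨fun k => ?_, popImageCard_zero_eq_catalan, popImageCard_one_eq_motzkin⟩
  obtain ⟨F, hF⟩ := PowerSeries.exists_quadratic k
  have hmk : (PowerSeries.mk fun n => (popImageCard k n : ℚ)) = F := by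
    ext n
    rw [PowerSeries.coeff_mk, popImageCard_eq_coeff hF]
  -- The root is read off from the quadratic formula solved for the square root; its square is the
  -- discriminant by the equation for `F`.
  refine ⟨1 - PowerSeries.X ^ (k + 1) - 2 * PowerSeries.X * (1 - PowerSeries.X) * F, by simp,
    ?_, ?_⟩
  · linear_combination (-4) * PowerSeries.X * (1 - PowerSeries.X) * hF
  · have h0 : (2 * PowerSeries.X * (1 - PowerSeries.X) : ℚ⟦X⟧) ≠ 0 := by
      refine mul_ne_zero (mul_ne_zero (fun h => ?_) PowerSeries.X_ne_zero) fun h => ?_ <;>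
      simpa [map_ofNat] using congrArg PowerSeries.constantCoeff h
    have h1 : ((2 * PowerSeries.X * (1 - PowerSeries.X) : ℚ⟦X⟧) : LaurentSeries ℚ) ≠ 0 :=
      fun h => h0 (HahnSeries.ofPowerSeries_injective (h.trans (map_zero _).symm))
    rw [hmk, eq_div_iff h1, ← PowerSeries.coe_mul]
    congr 1
    ring
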